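/- For each $n\ge 1$ let $X\in\mathbb{R}^n$ be normally distributed with unknown mean vector $m$ and identity covariance matrix, and consider testing $H_o\colon m=0$ at a fixed level $\alpha\in(0,1)$. A test is a measurable function $T\colon\mathbb{R}^n\to[0,1]$, with power $E_m(T(X))$ at $m$ and level $\alpha$ if $E_0(T(X))\le\alpha$; it is orthogonally invariant if $T(Px)=T(x)$ for every orthogonal transformation $P$ of $\mathbb{R}^n$ and every $x$. A best invariant test is an orthogonally invariant test of level $\alpha$ whose power at every $m\ne0$ is at least that of every other orthogonally invariant test of level $\alpha$. For $m\neq 0$ the level-$\alpha$ Neyman–Pearson test against $m$ rejects when $m^{\mathrm T}X/\|m\|$ exceeds its upper $\alpha$ quantile under $H_o$. Then for every $n\ge1$ a best invariant test exists. Let $T_n$ be any sequence of best invariant tests and let $m_n\in\mathbb{R}^n\setminus\{0\}$ be any sequence of alternatives such that the laws $N(m_n,I_n)$ are contiguous to $N(0,I_n)$ (that is, $P_{m_n}(A_n)\to0$ for all measurable sets $A_n\subseteq\mathbb{R}^n$ with $P_0(A_n)\to0$). Then for every $n\ge1$ there is $c_n>0$ such that the power of $T_n$ against $c_nm_n$ equals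 the power of the Neyman–Pearson test for $m_n$ against $m_n$, and for every such choice of the $c_n$, \[\lim_{n\to\infty}\frac{1}{c_n^2}=0 .\] That is, the best invariant test has asymptotic relative efficiency $0$ relative to the Neyman–Pearson test. -/

import Mathlib

open MeasureTheory ProbabilityTheory Filter Topology

noncomputable section

namespace InvariantTests

/-- The sample and parameter space `ℝⁿ` with its Euclidean structure. -/
abbrev Vec (n : ℕ) : Type := EuclideanSpace ℝ (Fin n)

/-- The law of the observation `X` when the mean vector is `m`: the normal distribution on `ℝⁿ`
with mean `m` and identity covariance matrix. -/
def normalLaw {n : ℕ} (m : Vec n) : Measure (Vec n) :=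
  multivariateGaussian m (1 : Matrix (Fin n) (Fin n) ℝ)

/-- A (possibly randomised) test function: measurable with values in `[0, 1]`; `T x` is the
probability of rejecting the null hypothesis when `x` is observed. -/
def IsTest {n : ℕ} (T : Vec n → ℝ) : Prop :=
  Measurable T ∧ ∀ x, 0 ≤ T x ∧ T x ≤ 1

/-- Invariance under the group of all orthogonal transformations of `ℝⁿ`. -/
def IsOrthInvariant {n : ℕ} (T : Vec n → ℝ) : Prop :=
  ∀ (P : Vec n ≃ₗᵢ[ℝ] Vec n) (x : Vec n), T (P x) = T x

/-- `E_m(T)`: the power of `T` at `m` (its level when `m = 0`). -/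
def power {n : ℕ} (T : Vec n → ℝ) (m : Vec n) : ℝ :=
  ∫ x, T x ∂(normalLaw m)

/-- `T` is an orthogonally invariant test of `m = 0` of level `α`. -/
def IsInvariantLevelTest {n : ℕ} (α : ℝ) (T : Vec n → ℝ) : Prop :=
  IsTest T ∧ IsOrthInvariant T ∧ power T 0 ≤ α

/-- `T` is a best (uniformly most powerful) level `α` test of `m = 0` against `m ≠ 0` among the
orthogonally invariant tests. -/
def IsBestInvariantTest {n : ℕ} (α : ℝ) (T : Vec n → ℝ) : Prop :=
  IsInvariantLevelTest α T ∧
    ∀ T' : Vec n → ℝ, IsInvariantLevelTest α T' → ∀ m : Vec n, m ≠ 0 → power T' m ≤ power T m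

/-- The Neyman-Pearson statistic `mᵀ x / ‖m‖` for testing `0` against the simple alternative
`m ≠ 0`. -/
def npStat {n : ℕ} (m x : Vec n) : ℝ :=
  inner ℝ m x / ‖m‖

/-- The critical value of the Neyman-Pearson test: the least `k` for which rejecting when the
statistic exceeds `k` has level at most `α`. (For `m ≠ 0` the statistic is standard normal under
the null hypothesis, so for `0 < α < 1` this is its upper `α` quantile, and the level is `α`.) -/
def npCritical {n : ℕ} (α : ℝ) (m : Vec n) : ℝ :=
  sInf {k : ℝ | (normalLaw (0 : Vec n)).real {x | k < npStat m x} ≤ α}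

/-- The level `α` Neyman-Pearson test of `0` against the simple alternative `m`. -/
def npTest {n : ℕ} (α : ℝ) (m : Vec n) : Vec n → ℝ :=
  Set.indicator {x | npCritical α m < npStat m x} (fun _ => 1)

/-- The sequence of laws `Q n` is contiguous to the sequence `P n`. -/
def Contiguous {Ω : ℕ → Type*} [∀ n, MeasurableSpace (Ω n)] (Q P : ∀ n, Measure (Ω n)) : Prop :=
  ∀ A : ∀ n, Set (Ω n), (∀ n, MeasurableSet (A n)) →
    Tendsto (fun n => P n (A n)) atTop (𝓝 0) → Tendsto (fun n => Q n (A n)) atTop (𝓝 0)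

/-- The scale `c > 0` is such that the power of `T` against `c m` equals the power of the level `α`
Neyman-Pearson test against `m`. The efficiency of `T` at `m` is then `1 / c²`. -/
def IsPowerScale {n : ℕ} (α : ℝ) (T : Vec n → ℝ) (m : Vec n) (c : ℝ) : Prop :=
  0 < c ∧ power T (c • m) = power (npTest α m) m

/-- The sequence of tests `T n` has asymptotic relative efficiency `e` with respect to the level `α`
Neyman-Pearson tests, along the sequence of alternatives `m n`: matching scales exist for every
sample size, and for every choice of them the efficiencies `1 / (c n)²` tend to `e`. -/
def HasARE (α : ℝ) (T : ∀ n, Vec n → ℝ) (m : ∀ n, Vec n) (e : ℝ) : Prop :=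
  (∀ n, 1 ≤ n → ∃ c : ℝ, IsPowerScale α (T n) (m n) c) ∧
    ∀ c : ℕ → ℝ, (∀ n, 1 ≤ n → IsPowerScale α (T n) (m n) (c n)) →
      Tendsto (fun n => 1 / (c n) ^ 2) atTop (𝓝 e)

end InvariantTests

end

/-!
The law `N(m, I)` has likelihood ratio `exp (⟪m, x⟫ - ‖m‖² / 2)` with respect to `N(0, I)`
(`integral_normalLaw`), and the products of two such ratios integrate to `exp ⟪m, m'⟫`
(`integral_likelihood_mul`).

*Best invariant tests.* An invariant test has the same power at all alternatives of a given norm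
(`IsOrthInvariant.power_eq_of_norm_eq`), so its power at `m` is its power against the uniform
mixture over the sphere of radius `‖m‖`. The likelihood ratio of that mixture is a nondecreasing
function of `‖x‖` (`meanLikelihood_mono`), so by the Neyman–Pearson argument the chi-square test,
which rejects when `‖x‖ > k`, is best invariant when `k` gives level exactly `α`
(`isBestInvariantTest_chiSqTest`). The power of a test is continuous in the mean, and that of a best
invariant test tends to one along rays, so matching scales exist
(`IsBestInvariantTest.exists_isPowerScale`).

*The rate.* For an upper bound on the power of an invariant test of `ℝⁿ`, the mixture over the `n`
orthogonal points `‖m‖ eᵢ` is enough: its likelihood ratio has variance `(exp (‖m‖²) - 1) / n` under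
the null hypothesis, and Cauchy–Schwarz bounds the gain over the level by the square root of this
(`sq_power_sub_level_le`), which is of order `‖m‖ / √n` for bounded `‖m‖`. The gain of the
Neyman–Pearson test is at least `δ ‖m‖` on bounded sets (`exists_mul_le_gaussian_tail_sub`), and
contiguity keeps `‖m n‖` bounded (`Contiguous.eventually_norm_le`). If the scale `c` stayed below a
constant `K`, comparing the two gains would bound `n` (`IsPowerScale.natCast_mul_sq_le`); so `c`
tends to infinity.
-/

namespace InvariantTests

/-! ### The Gaussian shift family and its likelihood ratios -/

lemma normalLaw_zero {n : ℕ} : normalLaw (0 : Vec n) = stdGaussian (Vec n) :=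
  multivariateGaussian_zero_one

lemma normalLaw_eq_map {n : ℕ} (m : Vec n) :
    normalLaw m = (stdGaussian (Vec n)).map (fun x => m + x) := by
  simp [normalLaw, multivariateGaussian]

instance isProbabilityMeasure_normalLaw {n : ℕ} (m : Vec n) :
    IsProbabilityMeasure (normalLaw m) := by
  unfold normalLaw; infer_instance

lemma integral_normalLaw_eq_shift {n : ℕ} (m : Vec n) (f : Vec n → ℝ) :
    ∫ x, f x ∂(normalLaw m) = ∫ x, f (m + x) ∂(stdGaussian (Vec n)) := by
  rw [normalLaw_eq_map]
  exact integral_map_equiv (MeasurableEquiv.addLeft m) f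

lemma integrable_exp_neg_half_norm_sq {n : ℕ} :
    Integrable (fun x : Vec n => Real.exp (-(1 / 2 : ℝ) * ‖x‖ ^ 2)) := by
  by_contra h
  have h1 := GaussianFourier.integral_rexp_neg_mul_sq_norm (V := Vec n)
    (show (0 : ℝ) < 1 / 2 by norm_num)
  rw [integral_undef h] at h1
  have : (0 : ℝ) < (Real.pi / (1 / 2)) ^ (Module.finrank ℝ (Vec n) / 2 : ℝ) := by positivity
  linarith

/-- The standard Gaussian law has Lebesgue density proportional to `exp (-‖x‖² / 2)`: both laws
have the same characteristic function. -/
lemma stdGaussian_eq_tilted {n : ℕ} :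
    stdGaussian (Vec n) =
      (volume : Measure (Vec n)).tilted (fun x => -(1 / 2 : ℝ) * ‖x‖ ^ 2) := by
  have : IsProbabilityMeasure
      ((volume : Measure (Vec n)).tilted (fun x => -(1 / 2 : ℝ) * ‖x‖ ^ 2)) :=
    isProbabilityMeasure_tilted integrable_exp_neg_half_norm_sq
  apply Measure.ext_of_charFun
  ext t
  rw [charFun_stdGaussian, charFun_apply, integral_tilted]
  have h2 : (0 : ℝ) < 1 / 2 := by norm_num
  have h1 := GaussianFourier.integral_rexp_neg_mul_sq_norm (V := Vec n) h2
  have hb : 0 < ((1 / 2 : ℂ)).re := by norm_num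
  have h3 := GaussianFourier.integral_cexp_neg_mul_sq_norm_add (V := Vec n) hb Complex.I t
  have h4 : (((Real.pi / (1 / 2)) ^ (Module.finrank ℝ (Vec n) / 2 : ℝ) : ℝ) : ℂ) =
      (Real.pi / (1 / 2 : ℂ)) ^ (Module.finrank ℝ (Vec n) / 2 : ℂ) := by
    rw [Complex.ofReal_cpow (by positivity)]
    push_cast
    rfl
  have h5 : ((Real.pi / (1 / 2)) ^ (Module.finrank ℝ (Vec n) / 2 : ℝ) : ℝ) ≠ 0 := by positivity
  rw [h1]
  have h6 : ∀ x : Vec n, ((Real.exp (-(1 / 2 : ℝ) * ‖x‖ ^ 2) /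
        (Real.pi / (1 / 2)) ^ (Module.finrank ℝ (Vec n) / 2 : ℝ) : ℝ)) •
        Complex.exp ((inner ℝ x t : ℝ) * Complex.I) =
      (((Real.pi / (1 / 2)) ^ (Module.finrank ℝ (Vec n) / 2 : ℝ) : ℝ) : ℂ)⁻¹ *
        Complex.exp (-(1 / 2 : ℂ) * ‖x‖ ^ 2 + Complex.I * (inner ℝ t x : ℝ)) := by
    intro x
    rw [Complex.exp_add, real_inner_comm x t, Complex.real_smul, mul_comm Complex.I]
    push_cast
    ring
  simp_rw [h6]
  rw [integral_const_mul, h3, ← h4, ← mul_assoc, inv_mul_cancel₀ (by exact_mod_cast h5), one_mul]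
  congr 1
  rw [Complex.I_sq]
  ring

/-- The likelihood ratio of `N(m, I)` with respect to `N(0, I)`. -/
noncomputable def likelihood {n : ℕ} (m x : Vec n) : ℝ :=
  Real.exp (inner ℝ m x - ‖m‖ ^ 2 / 2)

lemma likelihood_pos {n : ℕ} (m x : Vec n) : 0 < likelihood m x := Real.exp_pos _

lemma integral_normalLaw {n : ℕ} (m : Vec n) (f : Vec n → ℝ) :
    ∫ x, f x ∂(normalLaw m) = ∫ x, likelihood m x * f x ∂(stdGaussian (Vec n)) := by
  rw [integral_normalLaw_eq_shift, stdGaussian_eq_tilted, integral_tilted, integral_tilted,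
    ← integral_add_left_eq_self _ (-m)]
  congr 1
  ext x
  have h : Real.exp (-(1 / 2 : ℝ) * ‖-m + x‖ ^ 2) =
      Real.exp (-(1 / 2 : ℝ) * ‖x‖ ^ 2) * likelihood m x := by
    rw [likelihood, ← Real.exp_add, neg_add_eq_sub, norm_sub_rev, norm_sub_sq_real]
    congr 1
    ring
  rw [smul_eq_mul, smul_eq_mul, add_neg_cancel_left, h]
  ring

lemma integral_likelihood {n : ℕ} (m : Vec n) :
    ∫ x, likelihood m x ∂(stdGaussian (Vec n)) = 1 := by
  have := integral_normalLaw m (fun _ => 1)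
  simpa using this.symm

lemma integrable_likelihood {n : ℕ} (m : Vec n) :
    Integrable (likelihood m) (stdGaussian (Vec n)) := by
  by_contra h
  have := integral_likelihood m
  rw [integral_undef h] at this
  norm_num at this

lemma likelihood_mul_likelihood {n : ℕ} (m m' x : Vec n) :
    likelihood m x * likelihood m' x = Real.exp (inner ℝ m m') * likelihood (m + m') x := by
  simp only [likelihood, ← Real.exp_add, norm_add_sq_real, inner_add_left]
  congr 1
  ring

lemma integrable_likelihood_mul {n : ℕ} (m m' : Vec n) :
    Integrable (fun x => likelihood m x * likelihood m' x) (stdGaussian (Vec n)) := by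
  simp_rw [likelihood_mul_likelihood]
  exact (integrable_likelihood _).const_mul _

lemma integral_likelihood_mul {n : ℕ} (m m' : Vec n) :
    ∫ x, likelihood m x * likelihood m' x ∂(stdGaussian (Vec n)) = Real.exp (inner ℝ m m') := by
  simp_rw [likelihood_mul_likelihood]
  rw [integral_const_mul, integral_likelihood, mul_one]

/-! ### Powers of tests -/

lemma IsTest.integrable {n : ℕ} {T : Vec n → ℝ} (hT : IsTest T) (μ : Measure (Vec n))
    [IsFiniteMeasure μ] : Integrable T μ :=
  Integrable.of_bound hT.1.aestronglyMeasurable 1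
    (ae_of_all _ fun x => by rw [Real.norm_eq_abs, abs_of_nonneg (hT.2 x).1]; exact (hT.2 x).2)

lemma IsTest.integrable_mul {n : ℕ} {T : Vec n → ℝ} (hT : IsTest T) {μ : Measure (Vec n)}
    {f : Vec n → ℝ} (hf : Integrable f μ) : Integrable (fun x => f x * T x) μ :=
  hf.mul_bdd (c := 1) hT.1.aestronglyMeasurable
    (ae_of_all _ fun x => by rw [Real.norm_eq_abs, abs_of_nonneg (hT.2 x).1]; exact (hT.2 x).2)

lemma power_eq {n : ℕ} (T : Vec n → ℝ) (m : Vec n) :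
    power T m = ∫ x, likelihood m x * T x ∂(stdGaussian (Vec n)) := integral_normalLaw m T

lemma power_zero {n : ℕ} (T : Vec n → ℝ) : power T 0 = ∫ x, T x ∂(stdGaussian (Vec n)) := by
  rw [power, normalLaw_zero]

/-- Cauchy–Schwarz for a test `T` against a square integrable function. -/
lemma IsTest.sq_integral_mul_le {n : ℕ} {T : Vec n → ℝ} (hT : IsTest T) {μ : Measure (Vec n)}
    [IsProbabilityMeasure μ] {h : Vec n → ℝ} (hh : Integrable h μ)
    (hh2 : Integrable (fun x => h x ^ 2) μ) :
    (∫ x, h x * T x ∂μ) ^ 2 ≤ ∫ x, h x ^ 2 ∂μ := by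
  set a := ∫ x, h x * T x ∂μ with ha
  have h1 : ∫ x, 2 * a * (h x * T x) ∂μ ≤ ∫ x, (h x ^ 2 + a ^ 2) ∂μ := by
    apply integral_mono ((hT.integrable_mul hh).const_mul _) (hh2.add (integrable_const _))
    intro x
    obtain ⟨h0, h1⟩ := hT.2 x
    have : a ^ 2 * T x ^ 2 ≤ a ^ 2 :=
      mul_le_of_le_one_right (sq_nonneg a) (by nlinarith)
    change 2 * a * (h x * T x) ≤ h x ^ 2 + a ^ 2
    nlinarith [sq_nonneg (h x - a * T x)]
  rw [integral_const_mul, ← ha, integral_add hh2 (integrable_const _)] at h1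
  simp only [integral_const, probReal_univ, smul_eq_mul, one_mul] at h1
  nlinarith

/-- The difference of the powers is bounded by the `L²` distance of the likelihood ratios. -/
lemma IsTest.sq_power_sub_le {n : ℕ} {T : Vec n → ℝ} (hT : IsTest T) (m m' : Vec n) :
    (power T m - power T m') ^ 2 ≤
      Real.exp (inner ℝ m m) - 2 * Real.exp (inner ℝ m m') + Real.exp (inner ℝ m' m') := by
  have hm := integrable_likelihood m
  have hm' := integrable_likelihood m'
  have e : ∀ x, (likelihood m x - likelihood m' x) ^ 2 = likelihood m x * likelihood m x -
      2 * (likelihood m x * likelihood m' x) + likelihood m' x * likelihood m' x := by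
    intro x; ring
  have i1 := integrable_likelihood_mul m m
  have i2 := (integrable_likelihood_mul m m').const_mul 2
  have i3 := integrable_likelihood_mul m' m'
  have i12 : Integrable (fun x => likelihood m x * likelihood m x -
      2 * (likelihood m x * likelihood m' x)) (stdGaussian (Vec n)) := i1.sub i2
  have := hT.sq_integral_mul_le (hm.sub hm') (by
    simp only [Pi.sub_apply, e]
    exact i12.add i3)
  simp only [Pi.sub_apply, e] at this
  rw [integral_add i12 i3, integral_sub i1 i2, integral_const_mul] at this
  simp only [integral_likelihood_mul] at this
  convert this using 2
  rw [power_eq, power_eq, ← integral_sub (hT.integrable_mul hm) (hT.integrable_mul hm')]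
  simp only [sub_mul]

lemma IsTest.continuous_power {n : ℕ} {T : Vec n → ℝ} (hT : IsTest T) : Continuous (power T) := by
  rw [continuous_iff_continuousAt]
  intro m
  rw [ContinuousAt, tendsto_iff_dist_tendsto_zero]
  have hc : Continuous fun m' : Vec n => √(Real.exp (inner ℝ m' m') -
      2 * Real.exp (inner ℝ m' m) + Real.exp (inner ℝ m m)) := by fun_prop
  have h0 := hc.tendsto m
  rw [show Real.exp (inner ℝ m m) - 2 * Real.exp (inner ℝ m m) + Real.exp (inner ℝ m m) = 0 by ring,
    Real.sqrt_zero] at h0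
  refine squeeze_zero (fun _ => dist_nonneg) (fun m' => ?_) h0
  rw [Real.dist_eq]
  exact Real.abs_le_sqrt (hT.sq_power_sub_le m' m)

/-! ### Consequences of orthogonal invariance -/

/-- The orthogonal group acts transitively on spheres; a reflection does it. -/
lemma exists_isometry_apply_eq {n : ℕ} {v w : Vec n} (h : ‖v‖ = ‖w‖) :
    ∃ P : Vec n ≃ₗᵢ[ℝ] Vec n, P v = w :=
  ⟨_, Submodule.reflection_sub h⟩

lemma measurePreserving_isometry {n : ℕ} (P : Vec n ≃ₗᵢ[ℝ] Vec n) :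
    MeasurePreserving P (stdGaussian (Vec n)) (stdGaussian (Vec n)) :=
  ⟨P.continuous.measurable, stdGaussian_map P⟩

lemma integral_comp_isometry {n : ℕ} (P : Vec n ≃ₗᵢ[ℝ] Vec n) (f : Vec n → ℝ) :
    ∫ x, f (P x) ∂(stdGaussian (Vec n)) = ∫ x, f x ∂(stdGaussian (Vec n)) :=
  (measurePreserving_isometry P).integral_comp P.toHomeomorph.measurableEmbedding f

lemma IsOrthInvariant.power_eq_of_norm_eq {n : ℕ} {T : Vec n → ℝ} (hT : IsOrthInvariant T)
    {m m' : Vec n} (h : ‖m‖ = ‖m'‖) : power T m = power T m' := by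
  obtain ⟨P, rfl⟩ := exists_isometry_apply_eq h
  rw [power, power, integral_normalLaw_eq_shift, integral_normalLaw_eq_shift,
    ← integral_comp_isometry P (fun x => T (P m + x))]
  simp only [← map_add, hT P]

/-- The orthogonal group moves `m` to each of the `n` orthogonal vectors `‖m‖ eᵢ`, so an invariant
test does no better against `m` than against their uniform mixture, whose `χ²`-distance from the
null hypothesis is only `(exp (‖m‖²) - 1) / n`. -/
lemma sq_power_sub_level_le {n : ℕ} (hn : 1 ≤ n) {T : Vec n → ℝ} (hT : IsTest T)
    (hI : IsOrthInvariant T) (m : Vec n) :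
    (power T m - power T 0) ^ 2 ≤ (Real.exp (‖m‖ ^ 2) - 1) / n := by
  have hn0 : (n : ℝ) ≠ 0 := by positivity
  let e : Fin n → Vec n := fun i => ‖m‖ • EuclideanSpace.single i 1
  have he : ∀ i, ‖e i‖ = ‖m‖ := fun i => by simp [e, norm_smul]
  have hin : ∀ i j, inner ℝ (e i) (e j) = if i = j then ‖m‖ ^ 2 else 0 := by
    intro i j
    simp only [e, inner_smul_left, inner_smul_right, EuclideanSpace.inner_single_left]
    by_cases hij : i = j
    · subst hij; simp [sq]
    · simp [hij]
  let h : Vec n → ℝ := fun x => (n : ℝ)⁻¹ * ∑ i, likelihood (e i) x - 1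
  have hi1 : Integrable (fun x => (n : ℝ)⁻¹ * ∑ i, likelihood (e i) x) (stdGaussian (Vec n)) :=
    (integrable_finsetSum _ fun i _ => integrable_likelihood (e i)).const_mul _
  have hh : Integrable h (stdGaussian (Vec n)) := hi1.sub (integrable_const _)
  have hsq : ∀ x, h x ^ 2 = (n : ℝ)⁻¹ ^ 2 * (∑ i, ∑ j, likelihood (e i) x * likelihood (e j) x) -
      2 * ((n : ℝ)⁻¹ * ∑ i, likelihood (e i) x) + 1 := by
    intro x
    simp only [h, ← Finset.sum_mul_sum]
    ring
  have hi2 : Integrable (fun x => (n : ℝ)⁻¹ ^ 2 *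
      (∑ i, ∑ j, likelihood (e i) x * likelihood (e j) x)) (stdGaussian (Vec n)) :=
    (integrable_finsetSum _ fun i _ => integrable_finsetSum _ fun j _ =>
      integrable_likelihood_mul (e i) (e j)).const_mul _
  have hi12 : Integrable (fun x => (n : ℝ)⁻¹ ^ 2 *
      (∑ i, ∑ j, likelihood (e i) x * likelihood (e j) x) -
      2 * ((n : ℝ)⁻¹ * ∑ i, likelihood (e i) x)) (stdGaussian (Vec n)) := hi2.sub (hi1.const_mul 2)
  have hh2 : Integrable (fun x => h x ^ 2) (stdGaussian (Vec n)) := by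
    simp only [hsq]
    exact hi12.add (integrable_const _)
  have key := hT.sq_integral_mul_le hh hh2
  have hleft : ∫ x, h x * T x ∂(stdGaussian (Vec n)) = power T m - power T 0 := by
    have e1 : ∀ x, h x * T x = (n : ℝ)⁻¹ * (∑ i, likelihood (e i) x * T x) - T x := by
      intro x
      simp only [h, ← Finset.sum_mul]
      ring
    simp only [e1]
    rw [integral_sub ((integrable_finsetSum _ fun i _ =>
        hT.integrable_mul (integrable_likelihood (e i))).const_mul _) (hT.integrable _),
      integral_const_mul,
      integral_finsetSum _ fun i _ => hT.integrable_mul (integrable_likelihood (e i)), power_zero]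
    simp only [← power_eq, fun i => hI.power_eq_of_norm_eq (he i)]
    simp [hn0]
  have hright : ∫ x, h x ^ 2 ∂(stdGaussian (Vec n)) = (Real.exp (‖m‖ ^ 2) - 1) / n := by
    simp only [hsq]
    rw [integral_add hi12 (integrable_const _),
      integral_sub hi2 (hi1.const_mul 2), integral_const_mul, integral_const_mul,
      integral_const_mul, integral_finsetSum _ fun i _ => integrable_likelihood (e i),
      integral_finsetSum _ fun i _ => integrable_finsetSum _ fun j _ =>
        integrable_likelihood_mul (e i) (e j)]
    have e2 : ∀ i, ∫ x, ∑ j, likelihood (e i) x * likelihood (e j) x ∂(stdGaussian (Vec n)) =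
        Real.exp (‖m‖ ^ 2) + (n - 1) := by
      intro i
      rw [integral_finsetSum _ fun j _ => integrable_likelihood_mul (e i) (e j)]
      simp only [integral_likelihood_mul, hin]
      have : ∀ j, Real.exp (if i = j then ‖m‖ ^ 2 else 0) =
          (if i = j then Real.exp (‖m‖ ^ 2) - 1 else 0) + 1 := by
        intro j; split_ifs <;> simp
      simp only [this, Finset.sum_add_distrib, Finset.sum_ite_eq, Finset.mem_univ, if_true,
        Finset.sum_const, Finset.card_univ, Fintype.card_fin, nsmul_eq_mul, mul_one]
      ring
    simp only [e2, integral_likelihood, Finset.sum_const, Finset.card_univ, Fintype.card_fin,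
      nsmul_eq_mul, integral_const, probReal_univ, smul_eq_mul, mul_one]
    field_simp
    ring
  rwa [hleft, hright] at key

/-! ### Upper tails of atomless laws on the line -/

lemma real_Ioi_eq_one_sub_cdf (ν : Measure ℝ) [IsProbabilityMeasure ν] (k : ℝ) :
    ν.real (Set.Ioi k) = 1 - cdf ν k := by
  rw [cdf_eq_real, ← Set.compl_Iic, probReal_compl_eq_one_sub measurableSet_Iic]

lemma continuous_real_Ioi {ν : Measure ℝ} [IsProbabilityMeasure ν] (h : ∀ k, ν {k} = 0) :
    Continuous fun k => ν.real (Set.Ioi k) := by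
  simp only [real_Ioi_eq_one_sub_cdf]
  refine continuous_const.sub (continuous_iff_continuousAt.2 fun k => ?_)
  rw [(monotone_cdf ν).continuousAt_iff_leftLim_eq_rightLim, StieltjesFunction.rightLim_eq]
  have h1 := (cdf ν).measure_singleton k
  rw [measure_cdf, h k, eq_comm, ENNReal.ofReal_eq_zero] at h1
  exact le_antisymm ((monotone_cdf ν).leftLim_le le_rfl) (by linarith)

lemma tendsto_real_Ioi_atTop (ν : Measure ℝ) [IsProbabilityMeasure ν] :
    Tendsto (fun k => ν.real (Set.Ioi k)) atTop (𝓝 0) := by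
  simp only [real_Ioi_eq_one_sub_cdf]
  simpa using (tendsto_cdf_atTop ν).const_sub 1

lemma exists_real_Ioi_eq {ν : Measure ℝ} [IsProbabilityMeasure ν] (h : ∀ k, ν {k} = 0) {α : ℝ}
    (hα0 : 0 < α) (hα1 : α < 1) : ∃ k, ν.real (Set.Ioi k) = α := by
  have h0 := tendsto_real_Ioi_atTop ν
  have h1 : Tendsto (fun k => ν.real (Set.Ioi k)) atBot (𝓝 1) := by
    simp only [real_Ioi_eq_one_sub_cdf]
    simpa using (tendsto_cdf_atBot ν).const_sub 1
  obtain ⟨a, ha⟩ := (h0.eventually (gt_mem_nhds hα0)).exists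
  obtain ⟨b, hb⟩ := (h1.eventually (lt_mem_nhds hα1)).exists
  exact mem_range_of_exists_le_of_exists_ge (continuous_real_Ioi h) ⟨a, ha.le⟩ ⟨b, hb.le⟩

/-! ### The uniformly most powerful invariant test -/

lemma stdGaussian_sphere {n : ℕ} (hn : 1 ≤ n) (k : ℝ) :
    stdGaussian (Vec n) {x | ‖x‖ = k} = 0 := by
  have : NeZero n := ⟨by omega⟩
  rw [stdGaussian_eq_tilted]
  apply tilted_absolutelyContinuous
  have := Measure.addHaar_sphere (volume : Measure (Vec n)) 0 k
  rwa [show {x : Vec n | ‖x‖ = k} = Metric.sphere 0 k by ext; simp]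

/-- The point of the sphere of radius `r` in the direction of `y` (junk value `0` at `y = 0`).
For a standard normal `y` it is uniformly distributed on the sphere. -/
noncomputable def radial {n : ℕ} (r : ℝ) (y : Vec n) : Vec n := (r / ‖y‖) • y

lemma measurable_radial {n : ℕ} (r : ℝ) : Measurable (radial (n := n) r) := by
  unfold radial; fun_prop

lemma norm_radial {n : ℕ} {r : ℝ} (hr : 0 ≤ r) {y : Vec n} (hy : y ≠ 0) : ‖radial r y‖ = r := by
  have : ‖y‖ ≠ 0 := norm_ne_zero_iff.2 hy
  rw [radial, norm_smul, norm_div, norm_norm, Real.norm_of_nonneg hr, div_mul_cancel₀ _ this]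

lemma norm_radial_le {n : ℕ} {r : ℝ} (hr : 0 ≤ r) (y : Vec n) : ‖radial r y‖ ≤ r := by
  by_cases hy : y = 0
  · simpa [radial, hy] using hr
  · exact (norm_radial hr hy).le

lemma radial_isometry {n : ℕ} (r : ℝ) (P : Vec n ≃ₗᵢ[ℝ] Vec n) (y : Vec n) :
    radial r (P y) = P (radial r y) := by
  simp [radial]

lemma measurable_likelihood_radial {n : ℕ} (r : ℝ) :
    Measurable fun p : Vec n × Vec n => likelihood (radial r p.1) p.2 := by
  have h : Measurable fun p : Vec n × Vec n => radial r p.1 :=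
    (measurable_radial r).comp measurable_fst
  exact Real.measurable_exp.comp ((h.inner measurable_snd).sub ((h.norm.pow_const 2).div_const 2))

/-- The likelihood ratio of the uniform mixture of the alternatives of norm `r` with respect to
the null hypothesis. -/
noncomputable def meanLikelihood {n : ℕ} (r : ℝ) (x : Vec n) : ℝ :=
  ∫ y, likelihood (radial r y) x ∂(stdGaussian (Vec n))

lemma integrable_likelihood_radial {n : ℕ} {r : ℝ} (hr : 0 ≤ r) (x : Vec n) :
    Integrable (fun y => likelihood (radial r y) x) (stdGaussian (Vec n)) := by
  refine Integrable.of_bound ((measurable_likelihood_radial r).comp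
    measurable_prodMk_right).aestronglyMeasurable (Real.exp (r * ‖x‖)) (ae_of_all _ fun y => ?_)
  rw [Real.norm_of_nonneg (likelihood_pos _ _).le]
  apply Real.exp_le_exp.2
  have h1 := real_inner_le_norm (radial r y) x
  have h2 := mul_le_mul_of_nonneg_right (norm_radial_le hr y) (norm_nonneg x)
  nlinarith [sq_nonneg ‖radial r y‖]

lemma meanLikelihood_nonneg {n : ℕ} (r : ℝ) (x : Vec n) : 0 ≤ meanLikelihood r x :=
  integral_nonneg fun _ => (likelihood_pos _ _).le

lemma meanLikelihood_isometry {n : ℕ} (r : ℝ) (P : Vec n ≃ₗᵢ[ℝ] Vec n) (x : Vec n) :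
    meanLikelihood r (P x) = meanLikelihood r x := by
  rw [meanLikelihood, ← integral_comp_isometry P]
  congr 1
  ext y
  rw [radial_isometry, likelihood, likelihood, P.inner_map_map, P.norm_map]

/-- Pairing opposite directions turns the exponentials into hyperbolic cosines, which increase
along rays. -/
lemma meanLikelihood_smul_le {n : ℕ} {r : ℝ} (hr : 0 ≤ r) {t : ℝ} (ht0 : 0 ≤ t) (ht1 : t ≤ 1)
    (x : Vec n) : meanLikelihood r (t • x) ≤ meanLikelihood r x := by
  have h2 : ∀ x : Vec n, 2 * meanLikelihood r x =
      ∫ y, (likelihood (radial r y) x + likelihood (radial r y) (-x)) ∂(stdGaussian (Vec n)) := by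
    intro x
    rw [integral_add (integrable_likelihood_radial hr x) (integrable_likelihood_radial hr (-x)),
      two_mul]
    congr 1
    exact (meanLikelihood_isometry r (LinearIsometryEquiv.neg ℝ) x).symm
  have hcosh : ∀ d x : Vec n, likelihood d x + likelihood d (-x) =
      2 * Real.cosh (inner ℝ d x) * Real.exp (-(‖d‖ ^ 2 / 2)) := by
    intro d x
    rw [likelihood, likelihood, inner_neg_right, Real.cosh_eq, sub_eq_add_neg, sub_eq_add_neg,
      Real.exp_add, Real.exp_add]
    ring
  refine le_of_mul_le_mul_left ?_ (zero_lt_two (α := ℝ))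
  rw [h2, h2]
  apply integral_mono
    ((integrable_likelihood_radial hr _).add (integrable_likelihood_radial hr _))
    ((integrable_likelihood_radial hr _).add (integrable_likelihood_radial hr _))
  intro y
  change likelihood (radial r y) (t • x) + likelihood (radial r y) (-(t • x)) ≤
    likelihood (radial r y) x + likelihood (radial r y) (-x)
  rw [hcosh, hcosh]
  have : Real.cosh (inner ℝ (radial r y) (t • x)) ≤ Real.cosh (inner ℝ (radial r y) x) := by
    rw [Real.cosh_le_cosh, inner_smul_right, abs_mul, abs_of_nonneg ht0]
    exact mul_le_of_le_one_left (abs_nonneg _) ht1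
  gcongr

lemma meanLikelihood_mono {n : ℕ} {r : ℝ} (hr : 0 ≤ r) {x x' : Vec n} (h : ‖x‖ ≤ ‖x'‖) :
    meanLikelihood r x ≤ meanLikelihood r x' := by
  obtain ⟨P, hP⟩ : ∃ P : Vec n ≃ₗᵢ[ℝ] Vec n, P x = (‖x‖ / ‖x'‖) • x' := by
    apply exists_isometry_apply_eq
    by_cases hx : ‖x'‖ = 0
    · rw [norm_smul, hx, mul_zero]
      exact le_antisymm (hx ▸ h) (norm_nonneg _)
    · rw [norm_smul, norm_div, norm_norm, norm_norm, div_mul_cancel₀ _ hx]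
  rw [← meanLikelihood_isometry r P, hP]
  exact meanLikelihood_smul_le hr (by positivity) (div_le_one_of_le₀ h (norm_nonneg _)) x'

lemma integrable_prod_likelihood_radial {n : ℕ} (r : ℝ) :
    Integrable (fun p : Vec n × Vec n => likelihood (radial r p.1) p.2)
      ((stdGaussian (Vec n)).prod (stdGaussian (Vec n))) := by
  rw [integrable_prod_iff (measurable_likelihood_radial r).aestronglyMeasurable]
  refine ⟨ae_of_all _ fun y => integrable_likelihood (radial r y), ?_⟩
  simp only [Real.norm_of_nonneg (likelihood_pos _ _).le, integral_likelihood]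
  exact integrable_const _

/-- Averaging over the directions of the alternative does not change the power of an invariant
test. -/
lemma power_eq_integral_meanLikelihood {n : ℕ} (hn : 1 ≤ n) {T : Vec n → ℝ} (hT : IsTest T)
    (hI : IsOrthInvariant T) (m : Vec n) :
    power T m = ∫ x, meanLikelihood ‖m‖ x * T x ∂(stdGaussian (Vec n)) := by
  have h0 : ∀ᵐ y ∂(stdGaussian (Vec n)), y ≠ 0 := by
    have := stdGaussian_sphere hn 0
    simp only [norm_eq_zero] at this
    rw [ae_iff]
    simpa using this
  have h1 : ∫ y, power T (radial ‖m‖ y) ∂(stdGaussian (Vec n)) = power T m := by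
    rw [integral_congr_ae (g := fun _ => power T m)]
    · simp
    · filter_upwards [h0] with y hy
      exact hI.power_eq_of_norm_eq (norm_radial (norm_nonneg m) hy)
  rw [← h1]
  simp only [power_eq, meanLikelihood, ← integral_mul_const]
  have hi : Integrable (fun p : Vec n × Vec n => likelihood (radial ‖m‖ p.1) p.2 * T p.2)
      ((stdGaussian (Vec n)).prod (stdGaussian (Vec n))) := by
    refine (integrable_prod_likelihood_radial ‖m‖).mul_bdd (c := 1)
      (hT.1.comp measurable_snd).aestronglyMeasurable (ae_of_all _ fun p => ?_)
    rw [Real.norm_of_nonneg (hT.2 p.2).1]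
    exact (hT.2 p.2).2
  exact integral_integral_swap hi

lemma integrable_meanLikelihood {n : ℕ} (r : ℝ) :
    Integrable (meanLikelihood r) (stdGaussian (Vec n)) := by
  have := (integrable_prod_likelihood_radial (n := n) r).integral_prod_right
  exact this

/-- The test rejecting when `‖x‖ > k`, that is, the chi-square test. -/
noncomputable def chiSqTest (n : ℕ) (k : ℝ) : Vec n → ℝ := Set.indicator {x | k < ‖x‖} fun _ => 1

lemma measurableSet_lt_norm {n : ℕ} (k : ℝ) : MeasurableSet {x : Vec n | k < ‖x‖} :=
  measurableSet_lt measurable_const measurable_norm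

lemma isTest_indicator {n : ℕ} {s : Set (Vec n)} (hs : MeasurableSet s) :
    IsTest (s.indicator fun _ => (1 : ℝ)) :=
  ⟨measurable_const.indicator hs, fun x => by by_cases h : x ∈ s <;> simp [h]⟩

lemma isTest_chiSqTest (n : ℕ) (k : ℝ) : IsTest (chiSqTest n k) :=
  isTest_indicator (measurableSet_lt_norm k)

lemma isOrthInvariant_chiSqTest (n : ℕ) (k : ℝ) : IsOrthInvariant (chiSqTest n k) := by
  intro P x
  simp [chiSqTest, Set.indicator]

lemma power_indicator {n : ℕ} {s : Set (Vec n)} (hs : MeasurableSet s) (m : Vec n) :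
    power (s.indicator fun _ => (1 : ℝ)) m = (normalLaw m).real s := by
  rw [power, integral_indicator_const _ hs, smul_eq_mul, mul_one]

/-- The chi-square test whose level is exactly `α` is best invariant: by monotonicity of the
averaged likelihood ratio in the norm it is a Neyman–Pearson test for the averaged alternative. -/
lemma isBestInvariantTest_chiSqTest {n : ℕ} (hn : 1 ≤ n) {α k : ℝ} (hk : 0 ≤ k)
    (hα : power (chiSqTest n k) 0 = α) : IsBestInvariantTest α (chiSqTest n k) := by
  have hS := isTest_chiSqTest n k
  have hSI := isOrthInvariant_chiSqTest n k
  refine ⟨⟨hS, hSI, hα.le⟩, fun T ⟨hT, hTI, hTα⟩ m hm => ?_⟩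
  rw [power_eq_integral_meanLikelihood hn hT hTI, power_eq_integral_meanLikelihood hn hS hSI]
  -- The value of the averaged likelihood ratio on the critical sphere is the multiplier.
  set ℓ := meanLikelihood ‖m‖ (radial k m) with hℓ
  have hℓ0 : 0 ≤ ℓ := meanLikelihood_nonneg _ _
  have hrad : ‖radial k m‖ = k := norm_radial hk hm
  have hL := integrable_meanLikelihood (n := n) ‖m‖
  have i1 := hT.integrable_mul hL
  have i2 := hS.integrable_mul hL
  have j1 := (hT.integrable (stdGaussian (Vec n))).const_mul ℓ
  have j2 := (hS.integrable (stdGaussian (Vec n))).const_mul ℓ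
  have key : ∫ x, (ℓ * chiSqTest n k x - ℓ * T x) ∂(stdGaussian (Vec n)) ≤
      ∫ x, (meanLikelihood ‖m‖ x * chiSqTest n k x - meanLikelihood ‖m‖ x * T x)
        ∂(stdGaussian (Vec n)) := by
    apply integral_mono (j2.sub j1) (i2.sub i1)
    intro x
    change ℓ * chiSqTest n k x - ℓ * T x ≤
      meanLikelihood ‖m‖ x * chiSqTest n k x - meanLikelihood ‖m‖ x * T x
    obtain ⟨hx0, hx1⟩ := hT.2 x
    by_cases hx : k < ‖x‖
    · have := meanLikelihood_mono (norm_nonneg m) (hrad.trans_le hx.le)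
      simp only [chiSqTest, Set.indicator, Set.mem_ofPred_eq, hx, if_true]
      nlinarith
    · have := meanLikelihood_mono (norm_nonneg m) ((not_lt.1 hx).trans_eq hrad.symm)
      simp only [chiSqTest, Set.indicator, Set.mem_ofPred_eq, hx, if_false]
      nlinarith
  rw [integral_sub j2 j1, integral_sub i2 i1, integral_const_mul, integral_const_mul,
    ← power_zero, ← power_zero, hα] at key
  nlinarith [mul_le_mul_of_nonneg_left hTα hℓ0]

lemma exists_isBestInvariantTest_chiSqTest {n : ℕ} (hn : 1 ≤ n) {α : ℝ} (hα0 : 0 < α)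
    (hα1 : α < 1) : ∃ k, 0 ≤ k ∧ IsBestInvariantTest α (chiSqTest n k) := by
  let ν := (stdGaussian (Vec n)).map norm
  have : IsProbabilityMeasure ν := Measure.isProbabilityMeasure_map measurable_norm.aemeasurable
  obtain ⟨k, hk⟩ := exists_real_Ioi_eq (ν := ν) (fun k => by
    rw [Measure.map_apply measurable_norm (measurableSet_singleton k)]
    exact stdGaussian_sphere hn k) hα0 hα1
  rw [map_measureReal_apply measurable_norm measurableSet_Ioi] at hk
  have hk0 : 0 ≤ k := by
    by_contra! h
    rw [show (norm ⁻¹' Set.Ioi k : Set (Vec n)) = Set.univ from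
      Set.eq_univ_of_forall fun x => h.trans_le (norm_nonneg x), probReal_univ] at hk
    exact hα1.ne' hk
  refine ⟨k, hk0, isBestInvariantTest_chiSqTest hn hk0 ?_⟩
  rw [chiSqTest, power_indicator (measurableSet_lt_norm k), normalLaw_zero]
  exact hk

/-- The power of a best invariant test comes arbitrarily close to one along every ray: it
dominates a chi-square test. -/
lemma IsBestInvariantTest.exists_lt_power_smul {n : ℕ} (hn : 1 ≤ n) {α : ℝ} (hα0 : 0 < α)
    (hα1 : α < 1) {T : Vec n → ℝ} (hT : IsBestInvariantTest α T) {m : Vec n} (hm : m ≠ 0) {b : ℝ}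
    (hb : b < 1) : ∃ c : ℝ, 0 < c ∧ b < power T (c • m) := by
  obtain ⟨k, hk0, hk⟩ := exists_isBestInvariantTest_chiSqTest hn hα0 hα1
  let ν := (stdGaussian (Vec n)).map norm
  have : IsProbabilityMeasure ν := Measure.isProbabilityMeasure_map measurable_norm.aemeasurable
  obtain ⟨K, hK0, hK⟩ : ∃ K, 0 < K ∧ ν.real (Set.Ioi K) < 1 - b :=
    ((eventually_gt_atTop 0).and
      ((tendsto_real_Ioi_atTop ν).eventually (gt_mem_nhds (sub_pos.2 hb)))).exists
  rw [map_measureReal_apply measurable_norm measurableSet_Ioi] at hK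
  have hm0 : 0 < ‖m‖ := norm_pos_iff.2 hm
  have hc : 0 < (k + K + 1) / ‖m‖ := by positivity
  refine ⟨_, hc, ?_⟩
  refine lt_of_lt_of_le ?_ (hT.2 _ hk.1 _ (smul_ne_zero hc.ne' hm))
  rw [chiSqTest, power_indicator (measurableSet_lt_norm k), normalLaw_eq_map,
    map_measureReal_apply (measurable_const_add _) (measurableSet_lt_norm k)]
  have hsub : (norm ⁻¹' Set.Ioi K)ᶜ ⊆
      (fun x => ((k + K + 1) / ‖m‖) • m + x) ⁻¹' {x : Vec n | k < ‖x‖} := by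
    intro x hx
    have hx' : ‖x‖ ≤ K := not_lt.1 hx
    have h1 := norm_sub_le (((k + K + 1) / ‖m‖) • m + x) x
    rw [add_sub_cancel_right, norm_smul, Real.norm_of_nonneg hc.le, div_mul_cancel₀ _ hm0.ne'] at h1
    change k < ‖((k + K + 1) / ‖m‖) • m + x‖
    linarith
  have := measureReal_mono (μ := stdGaussian (Vec n)) hsub
  rw [probReal_compl_eq_one_sub (measurable_norm measurableSet_Ioi)] at this
  linarith

/-! ### The Neyman–Pearson test -/

lemma real_Ioi_sub_real_Ioi (ν : Measure ℝ) [IsFiniteMeasure ν] {a b : ℝ} (h : a ≤ b) :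
    ν.real (Set.Ioi a) - ν.real (Set.Ioi b) = ν.real (Set.Ioc a b) := by
  rw [← Set.Ioc_union_Ioi_eq_Ioi h, measureReal_union (Set.Ioc_disjoint_Ioi le_rfl)
    measurableSet_Ioi, add_sub_cancel_right]

/-- The upper tail of the standard normal law decreases at least linearly on bounded intervals,
since its density is bounded away from zero there. -/
lemma exists_mul_le_gaussian_tail_sub (z M : ℝ) :
    ∃ δ : ℝ, 0 < δ ∧ ∀ r, 0 ≤ r → r ≤ M →
      δ * r ≤ (gaussianReal 0 1).real (Set.Ioi (z - r)) - (gaussianReal 0 1).real (Set.Ioi z) := by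
  refine ⟨gaussianPDFReal 0 1 (|z| + M), gaussianPDFReal_pos 0 1 _ one_ne_zero, fun r hr0 hrM => ?_⟩
  rw [real_Ioi_sub_real_Ioi _ (by linarith), measureReal_def,
    gaussianReal_apply_eq_integral 0 one_ne_zero, ENNReal.toReal_ofReal
      (integral_nonneg fun x => gaussianPDFReal_nonneg 0 1 x)]
  have hconst : ∫ _ in Set.Ioc (z - r) z, gaussianPDFReal 0 1 (|z| + M) =
      gaussianPDFReal 0 1 (|z| + M) * r := by
    rw [setIntegral_const, Real.volume_real_Ioc_of_le (by linarith), smul_eq_mul]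
    ring
  rw [← hconst]
  apply setIntegral_mono_on (by simp) (integrable_gaussianPDFReal 0 1).integrableOn
    measurableSet_Ioc
  intro x hx
  have hx2 : x ^ 2 ≤ (|z| + M) ^ 2 := by
    apply sq_le_sq'
    · linarith [neg_abs_le z, hx.1]
    · linarith [le_abs_self z, hx.2]
  simp only [gaussianPDFReal_def, sub_zero]
  gcongr

lemma gaussian_tail_strictAnti :
    StrictAnti fun k => (gaussianReal 0 1).real (Set.Ioi k) := by
  intro a b hab
  obtain ⟨δ, hδ, h⟩ := exists_mul_le_gaussian_tail_sub b (b - a)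
  have := h (b - a) (by linarith) le_rfl
  rw [sub_sub_cancel] at this
  have := mul_pos hδ (sub_pos.2 hab)
  change (gaussianReal 0 1).real (Set.Ioi b) < (gaussianReal 0 1).real (Set.Ioi a)
  linarith

lemma exists_gaussian_tail_eq {α : ℝ} (hα0 : 0 < α) (hα1 : α < 1) :
    ∃ z, (gaussianReal 0 1).real (Set.Ioi z) = α := by
  have : NullSingletonClass (gaussianReal 0 1) := nullSingletonClass_gaussianReal one_ne_zero
  exact exists_real_Ioi_eq (fun k => measure_singleton k) hα0 hα1

lemma measurable_npStat {n : ℕ} (m : Vec n) : Measurable (npStat m) := by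
  unfold npStat; fun_prop

lemma map_npStat {n : ℕ} {m : Vec n} (hm : m ≠ 0) :
    (stdGaussian (Vec n)).map (npStat m) = gaussianReal 0 1 := by
  have h : npStat m = ⇑(innerSL ℝ (‖m‖⁻¹ • m)) := by
    ext x
    rw [innerSL_apply_apply, inner_smul_left, npStat, div_eq_inv_mul]
    simp
  have hnorm : ‖innerSL ℝ (‖m‖⁻¹ • m)‖ = 1 := by
    rw [innerSL_apply_norm, norm_smul, norm_inv, norm_norm, inv_mul_cancel₀ (norm_ne_zero_iff.2 hm)]
  rw [h, IsGaussian.map_eq_gaussianReal, integral_strongDual_stdGaussian,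
    variance_dual_stdGaussian, hnorm]
  simp

lemma normalLaw_lt_npStat {n : ℕ} {m : Vec n} (hm : m ≠ 0) (m' : Vec n) (k : ℝ) :
    (normalLaw m').real {x | k < npStat m x} =
      (gaussianReal 0 1).real (Set.Ioi (k - npStat m m')) := by
  rw [normalLaw_eq_map, map_measureReal_apply (measurable_const_add _)
      (measurableSet_lt measurable_const (measurable_npStat m)), ← map_npStat hm,
    map_measureReal_apply (measurable_npStat m) measurableSet_Ioi]
  congr 1
  ext x
  simp [npStat, inner_add_right, add_div, sub_lt_iff_lt_add']

lemma npStat_zero {n : ℕ} (m : Vec n) : npStat m 0 = 0 := by simp [npStat]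

lemma npStat_self {n : ℕ} {m : Vec n} (hm : m ≠ 0) : npStat m m = ‖m‖ := by
  rw [npStat, real_inner_self_eq_norm_mul_norm, mul_div_assoc, div_self (norm_ne_zero_iff.2 hm),
    mul_one]

lemma npCritical_eq {n : ℕ} {m : Vec n} (hm : m ≠ 0) {α z : ℝ}
    (hz : (gaussianReal 0 1).real (Set.Ioi z) = α) : npCritical α m = z := by
  have : {k : ℝ | (normalLaw (0 : Vec n)).real {x | k < npStat m x} ≤ α} = Set.Ici z := by
    ext k
    rw [Set.mem_ofPred_eq, normalLaw_lt_npStat hm, npStat_zero, sub_zero, ← hz]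
    exact gaussian_tail_strictAnti.le_iff_ge
  rw [npCritical, this, csInf_Ici]

lemma power_npTest {n : ℕ} {m : Vec n} (hm : m ≠ 0) {α z : ℝ}
    (hz : (gaussianReal 0 1).real (Set.Ioi z) = α) :
    power (npTest α m) m = (gaussianReal 0 1).real (Set.Ioi (z - ‖m‖)) := by
  rw [npTest, power_indicator (measurableSet_lt measurable_const (measurable_npStat m)),
    normalLaw_lt_npStat hm, npCritical_eq hm hz, npStat_self hm]

/-! ### Contiguous alternatives -/

/-- Contiguous alternatives are bounded: along a subsequence with `‖m n‖ → ∞` the half spaces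
`{x | ‖m n‖ / 2 < npStat (m n) x}` would separate the two sequences of laws. -/
lemma Contiguous.eventually_norm_le {m : (n : ℕ) → Vec n}
    (h : Contiguous (fun n => normalLaw (m n)) (fun n => normalLaw (0 : Vec n))) :
    ∃ M : ℝ, ∀ᶠ n in atTop, ‖m n‖ ≤ M := by
  classical
  by_contra hM
  push Not at hM
  obtain ⟨φ, hφ, hφm⟩ := extraction_forall_of_frequently (P := fun k n => (k : ℝ) < ‖m n‖)
    fun k => hM k
  have hne : ∀ k, m (φ k) ≠ 0 := fun k =>
    norm_pos_iff.1 ((Nat.cast_nonneg k).trans_lt (hφm k))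
  let A : (n : ℕ) → Set (Vec n) := fun n =>
    if n ∈ Set.range φ then {x | ‖m n‖ / 2 < npStat (m n) x} else ∅
  have hA : ∀ n, MeasurableSet (A n) := by
    intro n
    simp only [A]
    split_ifs
    · exact measurableSet_lt measurable_const (measurable_npStat (m n))
    · exact MeasurableSet.empty
  have hAφ : ∀ k, A (φ k) = {x | ‖m (φ k)‖ / 2 < npStat (m (φ k)) x} := fun k => if_pos ⟨k, rfl⟩
  have h0 : Tendsto (fun n => (normalLaw (0 : Vec n)).real (A n)) atTop (𝓝 0) := by
    rw [Metric.tendsto_atTop]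
    intro ε hε
    obtain ⟨t, ht⟩ := ((tendsto_real_Ioi_atTop (gaussianReal 0 1)).eventually
      (gt_mem_nhds hε)).exists
    obtain ⟨K, hK⟩ := exists_nat_ge (2 * t)
    refine ⟨φ K, fun n hn => ?_⟩
    rw [Real.dist_eq, sub_zero, abs_of_nonneg measureReal_nonneg]
    by_cases hr : n ∈ Set.range φ
    · obtain ⟨k, rfl⟩ := hr
      have hKk : (K : ℝ) ≤ k := by exact_mod_cast hφ.le_iff_le.1 hn
      rw [hAφ, normalLaw_lt_npStat (hne k), npStat_zero, sub_zero]
      refine lt_of_le_of_lt (gaussian_tail_strictAnti.antitone ?_) ht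
      linarith [hφm k]
    · simpa only [A, if_neg hr, measureReal_empty] using hε
  have h1 := h A hA
    ((ENNReal.tendsto_toReal_iff (fun n => measure_ne_top _ _) ENNReal.zero_ne_top).1 h0)
  have h2 := ((ENNReal.tendsto_toReal ENNReal.zero_ne_top).comp h1).comp hφ.tendsto_atTop
  have h3 : (gaussianReal 0 1).real (Set.Ioi 0) ≤ 0 := by
    refine ge_of_tendsto h2 (Eventually.of_forall fun k => ?_)
    change _ ≤ (normalLaw (m (φ k))).real (A (φ k))
    rw [hAφ, normalLaw_lt_npStat (hne k), npStat_self (hne k)]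
    apply gaussian_tail_strictAnti.antitone
    linarith [norm_nonneg (m (φ k))]
  have h4 := gaussian_tail_strictAnti (show (0 : ℝ) < 1 by norm_num)
  have h5 : 0 ≤ (gaussianReal 0 1).real (Set.Ioi 1) := measureReal_nonneg
  linarith

/-! ### The asymptotic relative efficiency -/

lemma IsBestInvariantTest.exists_isPowerScale {n : ℕ} (hn : 1 ≤ n) {α : ℝ} (hα0 : 0 < α)
    (hα1 : α < 1) {T : Vec n → ℝ} (hT : IsBestInvariantTest α T) {m : Vec n} (hm : m ≠ 0) :
    ∃ c, IsPowerScale α T m c := by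
  obtain ⟨z, hz⟩ := exists_gaussian_tail_eq hα0 hα1
  set b := power (npTest α m) m with hb
  rw [power_npTest hm hz] at hb
  have hm0 := norm_pos_iff.2 hm
  have hαb : α < b := by
    rw [hb, ← hz]
    exact gaussian_tail_strictAnti (by linarith)
  have hb1 : b < 1 := by
    rw [hb]
    exact (gaussian_tail_strictAnti (sub_one_lt (z - ‖m‖))).trans_le measureReal_le_one
  obtain ⟨c₁, hc₁, hbc⟩ := hT.exists_lt_power_smul hn hα0 hα1 hm hb1
  have hcont : Continuous fun c : ℝ => power T (c • m) :=
    hT.1.1.continuous_power.comp (continuous_id.smul continuous_const)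
  have h0 : power T ((0 : ℝ) • m) < b := by
    rw [zero_smul]
    exact hT.1.2.2.trans_lt hαb
  obtain ⟨c, hc, hcb⟩ := intermediate_value_Icc hc₁.le hcont.continuousOn ⟨h0.le, hbc.le⟩
  refine ⟨c, lt_of_le_of_ne hc.1 ?_, hcb⟩
  rintro rfl
  exact h0.ne hcb

/-- With a matching scale `c ≤ K`, the gain of the Neyman–Pearson test over its level, which is at
least `δ ‖m‖`, is at most the gain of the invariant test, which is `O(c ‖m‖ / √n)`. The norms cancel
and leave a bound on the dimension. -/
lemma IsPowerScale.natCast_mul_sq_le {n : ℕ} (hn : 1 ≤ n) {α z : ℝ}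
    (hz : (gaussianReal 0 1).real (Set.Ioi z) = α) {T : Vec n → ℝ}
    (hT : IsInvariantLevelTest α T) {m : Vec n} (hm : m ≠ 0) {c K M δ : ℝ}
    (hc : IsPowerScale α T m c) (hcK : c ≤ K) (hmM : ‖m‖ ≤ M) (hδ0 : 0 < δ)
    (hδ : δ * ‖m‖ ≤ (gaussianReal 0 1).real (Set.Ioi (z - ‖m‖)) -
      (gaussianReal 0 1).real (Set.Ioi z)) :
    n * δ ^ 2 ≤ K ^ 2 * Real.exp ((K * M) ^ 2) := by
  obtain ⟨hc0, hc⟩ := hc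
  have hm0 := norm_pos_iff.2 hm
  have hn0 : (0 : ℝ) < n := by exact_mod_cast hn
  have hgain : δ * ‖m‖ ≤ power T (c • m) - power T 0 := by
    rw [hc, power_npTest hm hz]
    linarith [hT.2.2]
  have h1 := (pow_le_pow_left₀ (by positivity) hgain 2).trans
    (sq_power_sub_level_le hn hT.1 hT.2.1 (c • m))
  have hexp : ∀ u : ℝ, Real.exp u - 1 ≤ u * Real.exp u := by
    intro u
    have h := mul_le_mul_of_nonneg_right (Real.add_one_le_exp (-u)) (Real.exp_pos u).le
    rw [← Real.exp_add, neg_add_cancel, Real.exp_zero] at h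
    linarith
  rw [norm_smul, Real.norm_of_nonneg hc0.le, le_div_iff₀ hn0] at h1
  have hK0 : 0 ≤ K := hc0.le.trans hcK
  have h2 : (c * ‖m‖) ^ 2 ≤ (K * M) ^ 2 := by gcongr
  have h3 : (δ * ‖m‖) ^ 2 * n ≤ (K * ‖m‖) ^ 2 * Real.exp ((K * M) ^ 2) := by
    refine (h1.trans (hexp _)).trans ?_
    gcongr
  refine le_of_mul_le_mul_right ?_ (pow_pos hm0 2)
  linarith

end InvariantTests

theorem corollary1 (α : ℝ) (hα0 : 0 < α) (hα1 : α < 1) :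
    (∀ n : ℕ, 1 ≤ n →
      ∃ T : InvariantTests.Vec n → ℝ, InvariantTests.IsBestInvariantTest α T) ∧
    ∀ T : (n : ℕ) → InvariantTests.Vec n → ℝ,
      (∀ n, 1 ≤ n → InvariantTests.IsBestInvariantTest α (T n)) →
      ∀ m : (n : ℕ) → InvariantTests.Vec n,
        (∀ n, 1 ≤ n → m n ≠ 0) →
        InvariantTests.Contiguous (fun n => InvariantTests.normalLaw (m n))
          (fun n => InvariantTests.normalLaw (0 : InvariantTests.Vec n)) →
        InvariantTests.HasARE α T m 0 := by
  open InvariantTests in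
  refine ⟨fun n hn => ?_, fun T hT m hm hcontig => ⟨fun n hn => ?_, fun c hc => ?_⟩⟩
  · obtain ⟨k, -, hk⟩ := exists_isBestInvariantTest_chiSqTest hn hα0 hα1
    exact ⟨_, hk⟩
  · exact (hT n hn).exists_isPowerScale hn hα0 hα1 (hm n hn)
  · obtain ⟨z, hz⟩ := exists_gaussian_tail_eq hα0 hα1
    obtain ⟨M, hM⟩ := hcontig.eventually_norm_le
    obtain ⟨δ, hδ0, hδ⟩ := exists_mul_le_gaussian_tail_sub z M
    have hctop : Tendsto c atTop atTop := by
      refine tendsto_atTop.2 fun K => ?_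
      filter_upwards [hM, eventually_ge_atTop 1, tendsto_natCast_atTop_atTop.eventually_gt_atTop
        (K ^ 2 * Real.exp ((K * M) ^ 2) / δ ^ 2)] with n hnM hn hnK
      by_contra! hcK
      have := (hc n hn).natCast_mul_sq_le hn hz (hT n hn).1 (hm n hn) hcK.le hnM hδ0
        (hδ _ (norm_nonneg _) hnM)
      rw [div_lt_iff₀ (pow_pos hδ0 2)] at hnK
      linarith
    simp only [one_div]
    exact ((tendsto_pow_atTop two_ne_zero).comp hctop).inv_tendsto_atTop
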